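/- Let $G$ be a non-abelian simple compact Lie group, that is, a compact (Hausdorff) connected non-abelian finite-dimensional real Lie group whose only closed connected normal subgroups are $1$ and $G$ (in particular, this covers the connected compact non-abelian Lie groups that are simple as abstract groups). For $x,g\in G$ write $[x,g]=x^{-1}g^{-1}xg$, and let $[x,{}_0g]=x$ and $[x,{}_{n+1}g]=[[x,{}_ng],g]$. An Engel sink of an element $g\in G$ is a set $\mathscr{E}(g)\subseteq G$ such that for every $x\in G$ there is a positive integer $n(x,g)$ with $[x,{}_ng]\in\mathscr{E}(g)$ for all $n\ge n(x,g)$. Then $G$ contains an element $g$ such that every Engel sink of $g$ is uncountable. -/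

import Mathlib

open scoped Manifold ContDiff

/-- The iterated commutator `[x, g, g, …, g]` with `g` repeated `n` times, left-normed, where
`[a, b] = a⁻¹ b⁻¹ a b`. -/
def engelCommutator {G : Type*} [Group G] (x g : G) : ℕ → G
  | 0 => x
  | n + 1 => (engelCommutator x g n)⁻¹ * g⁻¹ * engelCommutator x g n * g

/-- `S` is an Engel sink of `g`: for every `x` there is a positive integer `N` such that
`[x, g, …, g]` (`g` repeated `n` times) lies in `S` for all `n ≥ N`. -/
def IsEngelSink {G : Type*} [Group G] (g : G) (S : Set G) : Prop :=
  ∀ x : G, ∃ N : ℕ, 0 < N ∧ ∀ n : ℕ, N ≤ n → engelCommutator x g n ∈ S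

/-- Simplicity in the sense of Lie groups: the group is connected, nontrivial, and its only
closed connected normal subgroups are the trivial subgroup and the whole group. Every connected
group that is simple as an abstract group has this property; so do its connected finite covers,
such as `SU(2)`. -/
structure IsLieSimple (G : Type*) [Group G] [TopologicalSpace G] : Prop where
  connected : ConnectedSpace G
  nontrivial : Nontrivial G
  eq_bot_or_eq_top : ∀ N : Subgroup G, N.Normal → IsClosed (N : Set G) →
    IsConnected (N : Set G) → N = ⊥ ∨ N = ⊤

/-! Suppose every element has a countable Engel sink. The sink property passes to images, so it may
be studied in the compact connected linear group Ad(G), where analyticity is available.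

There Baire's theorem makes some map x ↦ [x, h, ..., h] constant on an open set. Analytic
continuation along x exp(tX) makes it trivial everywhere. Its linearization at 1 is (Ad(h⁻¹) - 1)^n,
so Ad(h⁻¹) is unipotent on the Lie algebra. Since its powers are bounded it is the identity, and h
is central (`IsEngelSink.mul_comm_of_countable`).

Thus Ad(G) is abelian, and the kernel of Ad contains all commutators. Simplicity makes this kernel
equal to G (`IsLieSimple.eq_top_of_commutator_mem`). A compact connected group with trivial adjoint
representation is abelian (`mul_comm_of_lieAd_eq_one`), a contradiction. -/

/-! ### Exponential and closed linear groups -/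

section UnitExp

open NormedSpace Filter Topology

variable {A : Type*} [NormedRing A] [NormedAlgebra ℝ A] [CompleteSpace A]

theorem exp_add_of_commute_real {X Y : A} (h : Commute X Y) :
    exp (X + Y) = exp X * exp Y :=
  letI : NormedAlgebra ℚ A := NormedAlgebra.restrictScalars ℚ ℝ A
  exp_add_of_commute h

theorem continuous_exp_real : Continuous (exp : A → A) :=
  continuous_iff_continuousAt.2 fun X => (exp_analytic (𝕂 := ℝ) X).continuousAt

/-- The exponential of an element of a real Banach algebra, as a unit. -/
noncomputable def unitExp (X : A) : Aˣ where
  val := exp X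
  inv := exp (-X)
  val_inv := by rw [← exp_add_of_commute_real (Commute.refl X).neg_right, add_neg_cancel, exp_zero]
  inv_val := by rw [← exp_add_of_commute_real (Commute.refl X).neg_left, neg_add_cancel, exp_zero]

@[simp] theorem val_unitExp (X : A) : (unitExp X : A) = exp X := rfl

@[simp] theorem val_inv_unitExp (X : A) : ((unitExp X)⁻¹ : Aˣ) = exp (-X) := rfl

@[simp] theorem unitExp_zero : unitExp (0 : A) = 1 := Units.ext (by simp)

theorem unitExp_neg (X : A) : unitExp (-X) = (unitExp X)⁻¹ := Units.ext rfl

theorem unitExp_add_of_commute {X Y : A} (h : Commute X Y) :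
    unitExp (X + Y) = unitExp X * unitExp Y :=
  Units.ext (exp_add_of_commute_real h)

theorem unitExp_nsmul (n : ℕ) (X : A) : unitExp (n • X) = unitExp X ^ n := by
  induction n with
  | zero => simp
  | succ n ih =>
    rw [succ_nsmul, unitExp_add_of_commute ((Commute.refl X).smul_left n), ih, pow_succ]

theorem unitExp_zsmul (n : ℤ) (X : A) : unitExp (n • X) = unitExp X ^ n := by
  cases n with
  | ofNat n => simpa using unitExp_nsmul n X
  | negSucc n => rw [negSucc_zsmul, unitExp_neg, unitExp_nsmul, zpow_negSucc]

theorem continuous_unitExp : Continuous (unitExp : A → Aˣ) :=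
  Units.continuous_iff.2 ⟨continuous_exp_real, continuous_exp_real.comp continuous_neg⟩

/-- If `exp Zᵢ` lies in the closed subgroup `S`, `Zᵢ → 0` and `cᵢ Zᵢ → W`, then `S` contains the
one-parameter group generated by `W`. -/
theorem unitExp_smul_mem_of_tendsto {S : Subgroup Aˣ} (hS : IsClosed (S : Set Aˣ)) {ι : Type*}
    {l : Filter ι} [l.NeBot] {Z : ι → A} {c : ι → ℝ} {W : A} (hZ : Tendsto Z l (𝓝 0))
    (hmem : ∀ᶠ i in l, unitExp (Z i) ∈ S) (hW : Tendsto (fun i => c i • Z i) l (𝓝 W)) (t : ℝ) :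
    unitExp (t • W) ∈ S := by
  -- Rounding `t * c i` down to an integer turns the multiple into a power of an element of `S`; the
  -- error is at most `‖Z i‖`.
  have h1 : Tendsto (fun i => ⌊t * c i⌋ • Z i) l (𝓝 (t • W)) := by
    have h2 : Tendsto (fun i => Int.fract (t * c i) • Z i) l (𝓝 0) := by
      refine squeeze_zero_norm (fun i => ?_) (tendsto_zero_iff_norm_tendsto_zero.1 hZ)
      rw [norm_smul, Real.norm_eq_abs, abs_of_nonneg (Int.fract_nonneg _)]
      exact mul_le_of_le_one_left (norm_nonneg _) (Int.fract_lt_one _).le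
    have h3 := (hW.const_smul t).sub h2
    rw [sub_zero] at h3
    refine h3.congr fun i => ?_
    rw [← Int.cast_smul_eq_zsmul ℝ, smul_smul, ← sub_smul, Int.self_sub_fract]
  refine hS.mem_of_tendsto ((continuous_unitExp.tendsto _).comp h1) ?_
  filter_upwards [hmem] with i hi
  simp only [Function.comp_apply, unitExp_zsmul]
  exact S.zpow_mem hi _

/-- Near s = 0, exp(sX) exp(sY) = exp(Z(s)) with Z'(0) = X + Y, so Z(s)/s gives the limit direction
required by `unitExp_smul_mem_of_tendsto`. -/
theorem unitExp_smul_add_mem {S : Subgroup Aˣ} (hS : IsClosed (S : Set Aˣ)) {X Y : A}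
    (hX : ∀ t : ℝ, unitExp (t • X) ∈ S) (hY : ∀ t : ℝ, unitExp (t • Y) ∈ S) (t : ℝ) :
    unitExp (t • (X + Y)) ∈ S := by
  have hexp : HasStrictFDerivAt (exp : A → A) ((ContinuousLinearEquiv.refl ℝ A : A ≃L[ℝ] A) :
      A →L[ℝ] A) 0 := hasStrictFDerivAt_exp_zero (𝕂 := ℝ)
  let L := hexp.localInverse
  let p : ℝ → A := fun s => exp (s • X) * exp (s • Y)
  have hp0 : p 0 = exp 0 := by simp [p]
  have hp : HasDerivAt p (X + Y) 0 := by
    have := (hasDerivAt_exp_smul_const (𝕂 := ℝ) X 0).mul (hasDerivAt_exp_smul_const (𝕂 := ℝ) Y 0)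
    simp only [zero_smul, exp_zero, one_mul, mul_one] at this
    exact this
  have hL : HasFDerivAt L (ContinuousLinearMap.id ℝ A) (p 0) := by
    rw [hp0]; exact hexp.to_localInverse.hasFDerivAt
  have hZ : HasDerivAt (L ∘ p) (X + Y) 0 := by simpa using hL.comp_hasDerivAt (0 : ℝ) hp
  have hZ0 : (L ∘ p) 0 = 0 := by
    simp only [Function.comp, hp0]; exact hexp.localInverse_apply_image
  have hright : ∀ᶠ s in 𝓝 (0 : ℝ), exp ((L ∘ p) s) = p s := by
    have := hexp.eventually_right_inverse
    rw [← hp0] at this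
    exact hp.continuousAt.eventually this
  refine unitExp_smul_mem_of_tendsto hS (l := 𝓝[≠] (0 : ℝ)) (Z := L ∘ p) (c := fun s => s⁻¹)
    ?_ ?_ ?_ t
  · have := hZ.continuousAt.tendsto
    rw [hZ0] at this
    exact this.mono_left nhdsWithin_le_nhds
  · filter_upwards [nhdsWithin_le_nhds hright] with s hs
    have : unitExp ((L ∘ p) s) = unitExp (s • X) * unitExp (s • Y) := Units.ext hs
    rw [this]
    exact S.mul_mem (hX s) (hY s)
  · have := hasDerivAt_iff_tendsto_slope.1 hZ
    simp only [slope_fun_def, hZ0, vsub_eq_sub, sub_zero] at this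
    exact this

/-- The Lie algebra of a closed subgroup of the units of a real Banach algebra. -/
noncomputable def Subgroup.expLie (S : Subgroup Aˣ) (hS : IsClosed (S : Set Aˣ)) : Submodule ℝ A where
  carrier := {X | ∀ t : ℝ, unitExp (t • X) ∈ S}
  add_mem' hX hY := unitExp_smul_add_mem hS hX hY
  zero_mem' t := by simp
  smul_mem' c X hX t := by rw [smul_smul]; exact hX _

theorem Subgroup.unitExp_mem {S : Subgroup Aˣ} {hS : IsClosed (S : Set Aˣ)} {X : A}
    (hX : X ∈ S.expLie hS) : unitExp X ∈ S := by simpa using hX 1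

variable [FiniteDimensional ℝ A]

/-- Otherwise there are nonzero counterexamples tending to 0. By compactness of the unit sphere
their directions accumulate at a unit vector, which lies both in the Lie algebra and in `m`. -/
theorem Subgroup.eventually_eq_zero_of_disjoint_expLie {S : Subgroup Aˣ}
    (hS : IsClosed (S : Set Aˣ)) {m : Submodule ℝ A} (hm : Disjoint (S.expLie hS) m) :
    ∀ᶠ Y in 𝓝 (0 : A), Y ∈ m → unitExp Y ∈ S → Y = 0 := by
  by_contra hcon
  rw [not_eventually] at hcon
  have hne : (𝓝 (0 : A) ⊓ 𝓟 {Y | ¬ (Y ∈ m → unitExp Y ∈ S → Y = 0)}).NeBot :=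
    frequently_mem_iff_neBot.1 hcon
  obtain ⟨u, hu⟩ := Ultrafilter.exists_le (𝓝 (0 : A) ⊓ 𝓟 {Y | ¬ (Y ∈ m → unitExp Y ∈ S → Y = 0)})
  have hu0 : Tendsto (fun Y : A => Y) u (𝓝 0) := hu.trans inf_le_left
  have hub : ∀ᶠ Y in (u : Filter A), Y ∈ m ∧ unitExp Y ∈ S ∧ Y ≠ 0 := by
    filter_upwards [hu.trans inf_le_right (mem_principal_self _)] with Y hY
    simpa using hY
  have hsph : ∀ᶠ Y in (u : Filter A), ‖Y‖⁻¹ • Y ∈ Metric.sphere (0 : A) 1 := by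
    filter_upwards [hub] with Y hY
    simp [norm_smul, hY.2.2]
  have : ProperSpace A := FiniteDimensional.proper_real A
  obtain ⟨W, hW1, hW⟩ := (isCompact_sphere (0 : A) 1).ultrafilter_le_nhds
    (u.map fun Y : A => ‖Y‖⁻¹ • Y) (le_principal_iff.2 hsph)
  have hW' : Tendsto (fun Y : A => ‖Y‖⁻¹ • Y) u (𝓝 W) := hW
  have hWS : W ∈ S.expLie hS := unitExp_smul_mem_of_tendsto hS hu0 (hub.mono fun Y h => h.2.1) hW'
  have hWm : W ∈ m := m.closed_of_finiteDimensional.mem_of_tendsto hW'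
    (hub.mono fun Y h => m.smul_mem _ h.1)
  have : W = 0 := by simpa using hm.le_bot (Submodule.mem_inf.2 ⟨hWS, hWm⟩)
  simp [this] at hW1

/-- For a complement `m`, (X, Y) ↦ exp X exp Y has surjective derivative at 0, so it covers a
neighbourhood of 1 by small pairs. If the product lies in `S`, so does exp Y, which forces Y = 0. -/
theorem Subgroup.eventually_mem_closure_expLie {S : Subgroup Aˣ} (hS : IsClosed (S : Set Aˣ)) :
    ∀ᶠ u in 𝓝 (1 : Aˣ), u ∈ S → u ∈ Subgroup.closure (unitExp '' (S.expLie hS : Set A)) := by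
  obtain ⟨m, hm⟩ := (S.expLie hS).exists_isCompl
  let F : (S.expLie hS) × m → A := fun p => exp (p.1 : A) * exp (p.2 : A)
  have h0 : HasStrictFDerivAt (exp : A → A) (1 : A →L[ℝ] A) 0 :=
    hasStrictFDerivAt_exp_zero (𝕂 := ℝ)
  let i₁ : (S.expLie hS) × m →L[ℝ] A := (S.expLie hS).subtypeL ∘L ContinuousLinearMap.fst ℝ _ _
  let i₂ : (S.expLie hS) × m →L[ℝ] A := m.subtypeL ∘L ContinuousLinearMap.snd ℝ _ _
  have hF : HasStrictFDerivAt F (i₁ + i₂) 0 := by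
    have h1 : HasStrictFDerivAt (fun p => exp (i₁ p)) ((1 : A →L[ℝ] A) ∘L i₁) 0 :=
      HasStrictFDerivAt.comp (g := exp) (0 : (S.expLie hS) × m) (by simpa using h0)
        i₁.hasStrictFDerivAt
    have h2 : HasStrictFDerivAt (fun p => exp (i₂ p)) ((1 : A →L[ℝ] A) ∘L i₂) 0 :=
      HasStrictFDerivAt.comp (g := exp) (0 : (S.expLie hS) × m) (by simpa using h0)
        i₂.hasStrictFDerivAt
    refine (h1.mul' h2).congr_fderiv ?_
    ext <;> simp [add_comm]
  have hsurj : (i₁ + i₂).range = ⊤ := by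
    rw [eq_top_iff]
    intro a _
    obtain ⟨x, hx, y, hy, rfl⟩ := Submodule.mem_sup.1 (hm.sup_eq_top ▸ Submodule.mem_top (x := a))
    exact ⟨(⟨x, hx⟩, ⟨y, hy⟩), by simp [i₁, i₂]⟩
  have hmap := hF.map_nhds_eq_of_surj hsurj
  have hF0 : F 0 = 1 := by simp [F]
  have hev : ∀ᶠ p in 𝓝 (0 : (S.expLie hS) × m), ∀ u : Aˣ, (u : A) = F p → u ∈ S →
      u ∈ Subgroup.closure (unitExp '' (S.expLie hS : Set A)) := by
    have hc : Tendsto (fun p : (S.expLie hS) × m => (p.2 : A)) (𝓝 0) (𝓝 0) := by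
      have : Continuous fun p : (S.expLie hS) × m => (p.2 : A) := by fun_prop
      simpa using this.tendsto 0
    filter_upwards [hc.eventually (eventually_eq_zero_of_disjoint_expLie hS hm.disjoint)]
      with p hp u hu huS
    have hu' : u = unitExp (p.1 : A) * unitExp (p.2 : A) := Units.ext hu
    have h2S : unitExp (p.2 : A) ∈ S := by
      have := S.mul_mem (S.inv_mem (unitExp_mem p.1.2)) huS
      rwa [hu', inv_mul_cancel_left] at this
    rw [hu', hp p.2.2 h2S, unitExp_zero, mul_one]
    exact subset_closure ⟨p.1, p.1.2, rfl⟩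
  have hA : ∀ᶠ a in 𝓝 (1 : A), ∀ u : Aˣ, (u : A) = a → u ∈ S →
      u ∈ Subgroup.closure (unitExp '' (S.expLie hS : Set A)) := by
    rw [← hF0, ← hmap]
    exact hev
  exact ((Units.continuous_val (M := A)).tendsto 1).eventually hA |>.mono fun u h => h u rfl

/-- A closed connected group of units of a finite-dimensional real algebra is generated by its
one-parameter subgroups. -/
theorem Subgroup.closure_expLie {S : Subgroup Aˣ} (hS : IsClosed (S : Set Aˣ))
    (hconn : IsConnected (S : Set Aˣ)) :
    Subgroup.closure (unitExp '' (S.expLie hS : Set A)) = S := by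
  set P := Subgroup.closure (unitExp '' (S.expLie hS : Set A))
  refine le_antisymm ((Subgroup.closure_le _).2 ?_) ?_
  · rintro _ ⟨X, hX, rfl⟩
    exact unitExp_mem hX
  have : ConnectedSpace S := isConnected_iff_connectedSpace.1 hconn
  have hopen : IsOpen (P.subgroupOf S : Set S) := by
    refine Subgroup.isOpen_of_mem_nhds _ (g := 1) ?_
    filter_upwards [(continuous_subtype_val.tendsto (1 : S)).eventually
      (eventually_mem_closure_expLie hS)] with u hu
    exact hu u.2
  have htop : (P.subgroupOf S : Set S) = Set.univ :=
    IsClopen.eq_univ ⟨Subgroup.isClosed_of_isOpen _ hopen, hopen⟩ ⟨1, one_mem _⟩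
  intro u hu
  have : (⟨u, hu⟩ : S) ∈ (P.subgroupOf S : Set S) := by rw [htop]; trivial
  exact this

end UnitExp

/-! ### Engel sinks and Baire category -/

section Engel

theorem map_engelCommutator {G K : Type*} [Group G] [Group K] (φ : G →* K) (x g : G) (n : ℕ) :
    φ (engelCommutator x g n) = engelCommutator (φ x) (φ g) n := by
  induction n with
  | zero => rfl
  | succ n ih => simp [engelCommutator, ih]

@[simp] theorem engelCommutator_one_left {G : Type*} [Group G] (g : G) (n : ℕ) :
    engelCommutator 1 g n = 1 := by
  induction n with
  | zero => rfl
  | succ n ih => simp [engelCommutator, ih]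

theorem continuous_engelCommutator {G : Type*} [Group G] [TopologicalSpace G]
    [IsTopologicalGroup G] (g : G) (n : ℕ) : Continuous fun x => engelCommutator x g n := by
  induction n with
  | zero => exact continuous_id
  | succ n ih => simp only [engelCommutator]; fun_prop

theorem IsEngelSink.image {G K : Type*} [Group G] [Group K] {φ : G →* K}
    (hφ : Function.Surjective φ) {g : G} {S : Set G} (hS : IsEngelSink g S) :
    IsEngelSink (φ g) (φ '' S) := fun y => by
  obtain ⟨x, rfl⟩ := hφ y
  obtain ⟨N, hN, h⟩ := hS x
  exact ⟨N, hN, fun n hn => ⟨_, h n hn, map_engelCommutator φ x g n⟩⟩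

/-- In a Baire group, an element with a countable Engel sink has an iterated commutator map that
is constant on a nonempty open set. -/
theorem IsEngelSink.exists_nonempty_interior_fiber {G : Type*} [Group G] [TopologicalSpace G]
    [IsTopologicalGroup G] [T1Space G] [BaireSpace G] {g : G} {S : Set G} (hS : IsEngelSink g S)
    (hc : S.Countable) :
    ∃ (n : ℕ) (s : G), (interior {x | engelCommutator x g n = s}).Nonempty := by
  have := hc.to_subtype
  obtain ⟨i, hi⟩ := nonempty_interior_of_iUnion_of_closed
    (f := fun p : ℕ × S => {x | engelCommutator x g p.1 = p.2})
    (fun p => isClosed_singleton.preimage (continuous_engelCommutator g p.1))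
    (Set.eq_univ_of_forall fun x => by
      obtain ⟨N, -, h⟩ := hS x
      exact Set.mem_iUnion.2 ⟨(N, ⟨_, h N le_rfl⟩), rfl⟩)
  exact ⟨i.1, i.2, hi⟩

end Engel

/-! ### Analytic curves of units -/

section AnalyticCurve

open NormedSpace Filter Topology

variable {A : Type*} [NormedRing A] [NormedAlgebra ℝ A]

/-- A curve of units which is analytic together with its inverse. -/
structure IsAnalyticCurve (c : ℝ → Aˣ) : Prop where
  val : AnalyticOnNhd ℝ (fun t => (c t : A)) Set.univ
  inv : AnalyticOnNhd ℝ (fun t => ((c t)⁻¹ : Aˣ).val) Set.univ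

theorem isAnalyticCurve_const (u : Aˣ) : IsAnalyticCurve fun _ => u :=
  ⟨analyticOnNhd_const, analyticOnNhd_const⟩

theorem IsAnalyticCurve.mul {c d : ℝ → Aˣ} (hc : IsAnalyticCurve c) (hd : IsAnalyticCurve d) :
    IsAnalyticCurve fun t => c t * d t :=
  ⟨by simpa using hc.val.mul hd.val, by simpa using hd.inv.mul hc.inv⟩

theorem IsAnalyticCurve.inverse {c : ℝ → Aˣ} (hc : IsAnalyticCurve c) :
    IsAnalyticCurve fun t => (c t)⁻¹ :=
  ⟨hc.inv, by simpa using hc.val⟩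

theorem IsAnalyticCurve.engelCommutator {c : ℝ → Aˣ} (hc : IsAnalyticCurve c) (h : Aˣ) (n : ℕ) :
    IsAnalyticCurve fun t => engelCommutator (c t) h n := by
  induction n with
  | zero => exact hc
  | succ n ih =>
    exact ((ih.inverse.mul (isAnalyticCurve_const h⁻¹)).mul ih).mul (isAnalyticCurve_const h)

theorem isAnalyticCurve_unitExp [CompleteSpace A] (X : A) :
    IsAnalyticCurve fun t : ℝ => unitExp (t • X) := by
  have key (Y : A) : AnalyticOnNhd ℝ (fun t : ℝ => exp (t • Y)) Set.univ := fun t _ =>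
    (exp_analytic (𝕂 := ℝ) (t • Y)).fun_comp (f := fun t : ℝ => t • Y)
      (analyticAt_id.smul analyticAt_const)
  exact ⟨key X, by simpa using key (-X)⟩

theorem IsAnalyticCurve.eq_of_eventuallyEq [CompleteSpace A] {c : ℝ → Aˣ} (hc : IsAnalyticCurve c)
    {s : Aˣ} (h : ∀ᶠ t in 𝓝 (0 : ℝ), c t = s) (t : ℝ) : c t = s :=
  Units.ext (hc.val.eqOn_of_preconnected_of_eventuallyEq (g := fun _ => (s : A))
    analyticOnNhd_const isPreconnected_univ (Set.mem_univ 0)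
    (h.mono fun _ ht => congrArg Units.val ht) (Set.mem_univ t))

end AnalyticCurve

/-! ### Countable sinks in compact linear groups -/

section Linear

open NormedSpace Filter Topology

variable {A : Type*} [NormedRing A] [NormedAlgebra ℝ A] [CompleteSpace A]

/-- Along t ↦ y exp(tX) the commutator is analytic and constant near t = 0, hence still equal to s
at t = 1. -/
theorem engelCommutator_mul_unitExp_eq {S : Subgroup Aˣ} {hS : IsClosed (S : Set Aˣ)} {h s y : S}
    {n : ℕ} (hy : y ∈ interior {x | engelCommutator x h n = s}) {X : A} (hX : X ∈ S.expLie hS) :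
    engelCommutator (y * ⟨unitExp X, S.unitExp_mem hX⟩) h n = s := by
  have han := ((isAnalyticCurve_const (y : Aˣ)).mul
    (isAnalyticCurve_unitExp X)).engelCommutator (h : Aˣ) n
  let c : ℝ → S := fun t => y * ⟨unitExp (t • X), hX t⟩
  have hcont : Continuous c := by
    refine continuous_const.mul (Continuous.subtype_mk ?_ _)
    exact continuous_unitExp.comp (continuous_id.smul continuous_const)
  have hc0 : c 0 = y := by ext; simp [c]
  have hev : ∀ᶠ t in 𝓝 (0 : ℝ), engelCommutator ((y : Aˣ) * unitExp (t • X)) h n = s := by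
    have : ∀ᶠ t in 𝓝 (0 : ℝ), c t ∈ interior {x | engelCommutator x h n = s} :=
      hcont.continuousAt.eventually_mem (isOpen_interior.mem_nhds (by rwa [hc0]))
    filter_upwards [this] with t ht
    have h0 : c t ∈ {x | engelCommutator x h n = s} := interior_subset ht
    have h1 : engelCommutator (c t) h n = s := h0
    have h2 := map_engelCommutator S.subtype (c t) h n
    rw [h1] at h2
    exact h2.symm
  have h1 := han.eq_of_eventuallyEq hev 1
  rw [one_smul] at h1
  exact Subtype.ext ((map_engelCommutator S.subtype _ h n).trans h1)

/-- Translation by exp X carries the interior to an open set on which the commutator is still s.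
Staying in the interior lets the argument be iterated over products of exponentials. -/
theorem mul_unitExp_mem_interior {S : Subgroup Aˣ} {hS : IsClosed (S : Set Aˣ)} {h s y : S}
    {n : ℕ} (hy : y ∈ interior {x | engelCommutator x h n = s}) {X : A} (hX : X ∈ S.expLie hS) :
    y * ⟨unitExp X, S.unitExp_mem hX⟩ ∈ interior {x | engelCommutator x h n = s} := by
  refine mem_interior.2 ⟨_, ?_, (Homeomorph.mulRight (⟨unitExp X, S.unitExp_mem hX⟩ : S)).isOpenMap
    _ isOpen_interior, ⟨y, hy, rfl⟩⟩
  rintro _ ⟨z, hz, rfl⟩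
  exact engelCommutator_mul_unitExp_eq hz hX

/-- In a closed connected linear group, an iterated commutator map that is constant on a nonempty
open set is trivial. -/
theorem engelCommutator_eq_one_of_interior_nonempty [FiniteDimensional ℝ A] {S : Subgroup Aˣ}
    (hS : IsClosed (S : Set Aˣ)) (hconn : IsConnected (S : Set Aˣ)) {h s : S} {n : ℕ}
    (hne : (interior {x | engelCommutator x h n = s}).Nonempty) (x : S) :
    engelCommutator x h n = 1 := by
  set W := interior {x | engelCommutator x h n = s} with hW
  -- The equivalence, rather than one implication, is what carries the induction through inverses.
  have key : ∀ u ∈ Subgroup.closure (unitExp '' (S.expLie hS : Set A)),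
      ∀ x y : S, (y : Aˣ) = x * u → (x ∈ W ↔ y ∈ W) := by
    intro u hu
    induction hu using Subgroup.closure_induction with
    | mem u hu =>
      obtain ⟨X, hX, rfl⟩ := hu
      intro x y hxy
      constructor
      · intro hx
        convert mul_unitExp_mem_interior hx hX
        exact Subtype.ext hxy
      · intro hy
        convert mul_unitExp_mem_interior hy ((S.expLie hS).neg_mem hX)
        refine Subtype.ext ?_
        simp [hxy, unitExp_neg]
    | one =>
      intro x y hxy
      have : y = x := Subtype.ext (by simpa using hxy)
      rw [this]
    | mul u v hu hv ihu ihv =>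
      intro x y hxy
      have huS : u ∈ S := by rwa [Subgroup.closure_expLie hS hconn] at hu
      exact (ihu x (x * ⟨u, huS⟩) rfl).trans (ihv _ y (by simp [hxy, mul_assoc]))
    | inv u hu ih =>
      intro x y hxy
      exact (ih y x (by simp [hxy])).symm
  obtain ⟨x₀, hx₀⟩ := hne
  have hall (y : S) : engelCommutator y h n = s := by
    have : y ∈ W := by
      refine (key (x₀⁻¹ * y : S) ?_ x₀ y (by simp)).1 hx₀
      rw [Subgroup.closure_expLie hS hconn]
      exact (x₀⁻¹ * y).2
    have h1 : y ∈ {x | engelCommutator x h n = s} := interior_subset this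
    exact h1
  -- Evaluating at the identity shows that the constant s is 1.
  rw [hall x, ← hall 1, engelCommutator_one_left]

/-- Every factor equals 1 at t = 0 up to h and h⁻¹, so the product rule gives one factor Ad(h⁻¹) - 1
per commutator. The derivative of the inverse is carried along because the recursion uses it. -/
theorem hasDerivAt_engelCommutator_unitExp (h : Aˣ) (X : A) (n : ℕ) :
    HasDerivAt (fun t : ℝ => (engelCommutator (unitExp (t • X)) h n).val)
      ((fun Z : A => (h⁻¹ : Aˣ) * Z * h - Z)^[n] X) 0 ∧
    HasDerivAt (fun t : ℝ => ((engelCommutator (unitExp (t • X)) h n)⁻¹ : Aˣ).val)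
      (-(fun Z : A => (h⁻¹ : Aˣ) * Z * h - Z)^[n] X) 0 := by
  induction n with
  | zero =>
    have h1 := hasDerivAt_exp_smul_const (𝕂 := ℝ) X 0
    have h2 := hasDerivAt_exp_smul_const (𝕂 := ℝ) (-X) 0
    simp only [zero_smul, exp_zero, one_mul] at h1 h2
    exact ⟨h1, by simpa [engelCommutator] using h2⟩
  | succ n ih =>
    obtain ⟨h1, h2⟩ := ih
    rw [Function.iterate_succ_apply']
    constructor
    · have := ((h2.mul_const ((h⁻¹ : Aˣ) : A)).mul h1).mul_const (h : A)
      simp only [zero_smul, unitExp_zero, engelCommutator_one_left, inv_one, Units.val_one,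
        one_mul, mul_one] at this
      simp only [engelCommutator, Units.val_mul]
      refine this.congr_deriv ?_
      simp [add_mul, mul_assoc, sub_eq_neg_add]
    · have := ((h2.const_mul ((h⁻¹ : Aˣ) : A)).mul_const (h : A)).mul h1
      simp only [zero_smul, unitExp_zero, engelCommutator_one_left, inv_one, Units.val_one,
        mul_one] at this
      simp only [engelCommutator, mul_inv_rev, inv_inv, Units.val_mul]
      refine (this.congr_deriv ?_).congr_of_eventuallyEq (.of_forall fun t => ?_)
      · simp [← sub_eq_neg_add]
      · simp [mul_assoc]

-- With T = Ad(h⁻¹), (T - 1)²Y = 0 gives T^k Y = Y + k(T - 1)Y, which is unbounded unless (T - 1)Y =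
-- 0.
omit [CompleteSpace A] in
theorem eq_zero_of_bounded_conj_pow {h : Aˣ} {Y : A} {C : ℝ}
    (hC : ∀ k : ℕ, ‖((h ^ k)⁻¹ : Aˣ) * Y * (h ^ k : Aˣ)‖ ≤ C)
    (hY : (h⁻¹ : Aˣ) * ((h⁻¹ : Aˣ) * Y * h - Y) * h - ((h⁻¹ : Aˣ) * Y * h - Y) = 0) :
    (h⁻¹ : Aˣ) * Y * h - Y = 0 := by
  set Z : A := (h⁻¹ : Aˣ) * Y * h - Y with hZ
  have hstep (k : ℕ) : ((h ^ k)⁻¹ : Aˣ) * Y * (h ^ k : Aˣ) = Y + (k : ℝ) • Z := by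
    induction k with
    | zero => simp
    | succ k ih =>
      have e1 : ((h ^ (k + 1))⁻¹ : Aˣ) * Y * (h ^ (k + 1) : Aˣ) =
          (h⁻¹ : Aˣ) * (((h ^ k)⁻¹ : Aˣ) * Y * (h ^ k : Aˣ)) * (h : A) := by
        rw [pow_succ, mul_inv_rev]; simp only [Units.val_mul, mul_assoc]
      have e2 : (h⁻¹ : Aˣ) * Z * h = Z := sub_eq_zero.1 hY
      have e3 : (h⁻¹ : Aˣ) * Y * h = Y + Z := by rw [hZ]; abel
      rw [e1, ih, mul_add, add_mul, mul_smul_comm, smul_mul_assoc, e2, e3]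
      push_cast
      rw [add_smul, one_smul]; abel
  by_contra hne
  obtain ⟨k, hk⟩ := exists_nat_gt ((C + ‖Y‖) / ‖Z‖)
  rw [div_lt_iff₀ (norm_pos_iff.2 hne)] at hk
  have h1 := hC k
  rw [hstep] at h1
  have h2 : ‖(k : ℝ) • Z‖ ≤ ‖Y + (k : ℝ) • Z‖ + ‖Y‖ := by
    simpa using norm_sub_le (Y + (k : ℝ) • Z) Y
  rw [norm_smul, Real.norm_natCast] at h2
  linarith

omit [NormedAlgebra ℝ A] [CompleteSpace A] in
theorem Subgroup.exists_norm_conj_le {S : Subgroup Aˣ} (hc : IsCompact (S : Set Aˣ)) (Y : A) :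
    ∃ C : ℝ, ∀ u ∈ S, ‖(u⁻¹ : Aˣ) * Y * (u : A)‖ ≤ C := by
  have hcont : Continuous fun u : Aˣ => ((u⁻¹ : Aˣ) : A) * Y * (u : A) :=
    (Units.continuous_coe_inv.mul continuous_const).mul Units.continuous_val
  exact hc.exists_bound_of_continuousOn hcont.continuousOn

/-- An element of a compact connected linear group with a countable Engel sink is central. -/
theorem IsEngelSink.mul_comm_of_countable [FiniteDimensional ℝ A] {S : Subgroup Aˣ}
    (hc : IsCompact (S : Set Aˣ)) (hconn : IsConnected (S : Set Aˣ)) {h : S} {T : Set S}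
    (hT : IsEngelSink h T) (hcount : T.Countable) (x : S) : h * x = x * h := by
  have hS : IsClosed (S : Set Aˣ) := hc.isClosed
  have : CompactSpace S := isCompact_iff_compactSpace.1 hc
  obtain ⟨n, s, hne⟩ := hT.exists_nonempty_interior_fiber hcount
  have hone := engelCommutator_eq_one_of_interior_nonempty hS hconn hne
  have hlie (X : A) (hX : X ∈ S.expLie hS) : ((h : Aˣ)⁻¹ : Aˣ) * X * (h : Aˣ) - X = 0 := by
    have hn : (fun Z : A => ((h : Aˣ)⁻¹ : Aˣ) * Z * (h : Aˣ) - Z)^[n] X = 0 := by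
      refine (hasDerivAt_engelCommutator_unitExp (h : Aˣ) X n).1.unique ?_
      have hconst (t : ℝ) : engelCommutator (unitExp (t • X)) (h : Aˣ) n = 1 := by
        have := map_engelCommutator S.subtype ⟨unitExp (t • X), hX t⟩ h n
        rw [hone, map_one] at this
        exact this.symm
      simp only [hconst]
      exact hasDerivAt_const _ _
    -- Nilpotency is lowered step by step: the induction hypothesis at (T - 1)Y gives (T - 1)²Y = 0,
    -- and boundedness on the compact group gives (T - 1)Y = 0.
    have hstep (m : ℕ) (Y : A) (hY : (fun Z : A => ((h : Aˣ)⁻¹ : Aˣ) * Z * (h : Aˣ) - Z)^[m] Y = 0) :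
        ((h : Aˣ)⁻¹ : Aˣ) * Y * (h : Aˣ) - Y = 0 := by
      induction m generalizing Y with
      | zero => simp [show Y = 0 from hY]
      | succ m ih =>
        obtain ⟨C, hC⟩ := Subgroup.exists_norm_conj_le hc Y
        exact eq_zero_of_bounded_conj_pow (fun k => hC _ (S.pow_mem h.2 k)) (ih _ hY)
    exact hstep n X hn
  have hle : Subgroup.closure (unitExp '' (S.expLie hS : Set A)) ≤
      Subgroup.centralizer {(h : Aˣ)} := by
    rw [Subgroup.closure_le]
    rintro _ ⟨X, hX, rfl⟩
    refine Subgroup.mem_centralizer_singleton_iff.2 (Units.ext ?_)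
    have : Commute ((h : Aˣ) : A) X := by
      have h1 := sub_eq_zero.1 (hlie X hX)
      have : ((h : Aˣ) : A) * (((h : Aˣ)⁻¹ : Aˣ) * X * (h : Aˣ)) = X * (h : Aˣ) := by
        rw [mul_assoc, Units.mul_inv_cancel_left]
      rw [h1] at this
      exact this
    exact this.exp_right.symm.eq
  rw [Subgroup.closure_expLie hS hconn] at hle
  exact Subtype.ext (Subgroup.mem_centralizer_singleton_iff.1 (hle x.2)).symm

end Linear

/-! ### The adjoint representation in a chart -/

section Adjoint

open Filter Topology

variable {E : Type*} [NormedAddCommGroup E] [NormedSpace ℝ E]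
  {H : Type*} [TopologicalSpace H] (I : ModelWithCorners ℝ E H)
  {G : Type*} [Group G] [TopologicalSpace G] [ChartedSpace H G]

/-- Conjugation by `g`, read in the preferred chart at the identity. -/
noncomputable def conjChart (g : G) (v : E) : E :=
  extChartAt I (1 : G) (g * (extChartAt I (1 : G)).symm v * g⁻¹)

theorem conjChart_extChartAt (g : G) {x : G} (hx : x ∈ (extChartAt I (1 : G)).source) :
    conjChart I g (extChartAt I (1 : G) x) = extChartAt I (1 : G) (g * x * g⁻¹) := by
  rw [conjChart, (extChartAt I (1 : G)).left_inv hx]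

theorem conjChart_extChartAt_one (g : G) :
    conjChart I g (extChartAt I (1 : G) 1) = extChartAt I (1 : G) 1 := by
  rw [conjChart_extChartAt I g (mem_extChartAt_source 1)]; simp

variable [I.Boundaryless] [LieGroup I ∞ G]

theorem contMDiffAt_extChartAt_symm (g : G) :
    ContMDiffAt 𝓘(ℝ, E) I ∞ (extChartAt I g).symm (extChartAt I g g) := by
  have : IsManifold I ∞ G := ContMDiffMul.toIsManifold
  exact (contMDiffOn_extChartAt_symm g).contMDiffAt (extChartAt_target_mem_nhds g)

/-- Smoothness is joint, with the group element read in the chart at g; this gives both continuity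
of Ad and control of derivatives near the identity. -/
theorem contDiffAt_conjChart (g : G) :
    ContDiffAt ℝ ∞ (fun p : E × E => conjChart I ((extChartAt I g).symm p.1) p.2)
      (extChartAt I g g, extChartAt I (1 : G) 1) := by
  have : IsManifold I ∞ G := ContMDiffMul.toIsManifold
  rw [← contMDiffAt_iff_contDiffAt]
  have h1 : ContMDiffAt 𝓘(ℝ, E × E) I ∞ (fun p : E × E => (extChartAt I g).symm p.1)
      (extChartAt I g g, extChartAt I (1 : G) 1) :=
    ContMDiffAt.comp (I' := 𝓘(ℝ, E)) _ (contMDiffAt_extChartAt_symm I g) contDiffAt_fst.contMDiffAt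
  have h2 : ContMDiffAt 𝓘(ℝ, E × E) I ∞ (fun p : E × E => (extChartAt I (1 : G)).symm p.2)
      (extChartAt I g g, extChartAt I (1 : G) 1) :=
    ContMDiffAt.comp (I' := 𝓘(ℝ, E)) _ (contMDiffAt_extChartAt_symm I (1 : G))
      contDiffAt_snd.contMDiffAt
  have h3 := (h1.mul h2).mul h1.inv
  refine ContMDiffAt.comp (I' := I) _ ?_ h3
  simpa using contMDiffAt_extChartAt (I := I) (n := ∞) (x := (1 : G))

omit [I.Boundaryless] [LieGroup I ∞ G] in
theorem tendsto_extChartAt_prod (g : G) :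
    Tendsto (fun p : G × E => (extChartAt I g p.1, p.2)) (𝓝 (g, extChartAt I (1 : G) 1))
      (𝓝 (extChartAt I g g, extChartAt I (1 : G) 1)) := by
  rw [nhds_prod_eq, nhds_prod_eq]
  exact (continuousAt_extChartAt g).tendsto.prodMap tendsto_id

omit [I.Boundaryless] [LieGroup I ∞ G] in
theorem eventually_extChartAt_symm_prod (g : G) :
    ∀ᶠ p in 𝓝 (g, extChartAt I (1 : G) 1), (extChartAt I g).symm (extChartAt I g p.1) = p.1 := by
  have : ∀ᶠ x in 𝓝 g, (extChartAt I g).symm (extChartAt I g x) = x := by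
    filter_upwards [extChartAt_source_mem_nhds (I := I) g] with x hx
    exact (extChartAt I g).left_inv hx
  exact (continuous_fst.tendsto (g, extChartAt I (1 : G) 1)).eventually this

theorem eventually_differentiableAt_conjChart (g : G) :
    ∀ᶠ p in 𝓝 (g, extChartAt I (1 : G) 1), DifferentiableAt ℝ (conjChart I p.1) p.2 := by
  have h1 := ((contDiffAt_conjChart I g).of_le (m := 1) (by norm_num)).eventually (by simp)
  filter_upwards [(tendsto_extChartAt_prod I g).eventually h1,
    eventually_extChartAt_symm_prod I g] with p hp hpg
  have h2 := hp.differentiableAt one_ne_zero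
  have h3 := DifferentiableAt.comp p.2 h2
    (f := fun v : E => (extChartAt I g p.1, v)) (by fun_prop)
  simp only [Function.comp_def, hpg] at h3
  exact h3

theorem continuousAt_fderiv_conjChart (g : G) :
    ContinuousAt (fun p : G × E => fderiv ℝ (conjChart I p.1) p.2)
      (g, extChartAt I (1 : G) 1) := by
  have h1 : ContDiffAt ℝ 0 (fun p : E × E =>
      fderiv ℝ (conjChart I ((extChartAt I g).symm p.1)) p.2)
      (extChartAt I g g, extChartAt I (1 : G) 1) := by
    refine ContDiffAt.fderiv (n := 1)
      (f := fun p : E × E => conjChart I ((extChartAt I g).symm p.1)) (g := Prod.snd)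
      ?_ contDiffAt_snd (by norm_num)
    exact ContDiffAt.comp ((extChartAt I g g, extChartAt I (1 : G) 1), extChartAt I (1 : G) 1)
      (g := fun p : E × E => conjChart I ((extChartAt I g).symm p.1) p.2)
      (f := fun q : (E × E) × E => (q.1.1, q.2))
      ((contDiffAt_conjChart I g).of_le (by norm_num)) (by fun_prop)
  have h2 := h1.continuousAt.tendsto.comp (tendsto_extChartAt_prod I g)
  have hg : (extChartAt I g).symm (extChartAt I g g) = g := extChartAt_to_inv g
  rw [hg] at h2
  refine h2.congr' ?_
  filter_upwards [eventually_extChartAt_symm_prod I g] with p hp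
  simp only [Function.comp_apply, hp]

theorem differentiableAt_conjChart (g : G) :
    DifferentiableAt ℝ (conjChart I g) (extChartAt I (1 : G) 1) :=
  (eventually_differentiableAt_conjChart I g).self_of_nhds

/-- The adjoint representation of a Lie group, on the model space, read in the preferred chart at
the identity. -/
noncomputable def lieAd : G →* (E →L[ℝ] E) where
  toFun g := fderiv ℝ (conjChart I g) (extChartAt I (1 : G) 1)
  map_one' := by
    have : conjChart I (1 : G) =ᶠ[𝓝 (extChartAt I (1 : G) 1)] id := by
      filter_upwards [extChartAt_target_mem_nhds (I := I) (1 : G)] with v hv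
      rw [conjChart, one_mul, inv_one, mul_one, (extChartAt I (1 : G)).right_inv hv, id]
    rw [this.fderiv_eq, fderiv_id]; rfl
  map_mul' g h := by
    have : IsTopologicalGroup G := topologicalGroup_of_lieGroup I ∞
    have key : conjChart I (g * h) =ᶠ[𝓝 (extChartAt I (1 : G) 1)]
        conjChart I g ∘ conjChart I h := by
      have hcont : ContinuousAt (fun v => h * (extChartAt I (1 : G)).symm v * h⁻¹)
          (extChartAt I (1 : G) 1) :=
        (continuousAt_const.mul (continuousAt_extChartAt_symm (1 : G))).mul continuousAt_const
      have hsrc : ∀ᶠ v in 𝓝 (extChartAt I (1 : G) 1),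
          h * (extChartAt I (1 : G)).symm v * h⁻¹ ∈ (extChartAt I (1 : G)).source := by
        refine hcont.eventually_mem ?_
        simpa using extChartAt_source_mem_nhds (I := I) (1 : G)
      filter_upwards [hsrc] with v hv
      simp only [Function.comp_apply]
      rw [show conjChart I h v = extChartAt I (1 : G) (h * (extChartAt I (1 : G)).symm v * h⁻¹)
        from rfl, conjChart_extChartAt I g hv, conjChart]
      simp [mul_assoc]
    rw [key.fderiv_eq, fderiv_comp _ _ (differentiableAt_conjChart I h),
      conjChart_extChartAt_one]
    · rfl
    · rw [conjChart_extChartAt_one]; exact differentiableAt_conjChart I g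

theorem continuous_lieAd : Continuous (lieAd I : G →* (E →L[ℝ] E)) :=
  continuous_iff_continuousAt.2 fun g =>
    (continuousAt_fderiv_conjChart I g).comp (f := fun x : G => (x, extChartAt I (1 : G) 1))
      (by fun_prop)

variable [CompactSpace G]

/-- The derivative is the identity at the base point and jointly continuous there; compactness of G
makes the neighbourhood uniform in g. -/
theorem eventually_forall_norm_fderiv_conjChart_sub_le (h : ∀ g : G, lieAd I g = 1) :
    ∀ᶠ v in 𝓝 (extChartAt I (1 : G) 1), ∀ g : G, DifferentiableAt ℝ (conjChart I g) v ∧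
      ‖fderiv ℝ (conjChart I g) v - ContinuousLinearMap.id ℝ E‖ ≤ 1 / 2 := by
  have := isCompact_univ.eventually_forall_of_forall_eventually
    (x₀ := extChartAt I (1 : G) 1) (K := (Set.univ : Set G))
    (P := fun v g => DifferentiableAt ℝ (conjChart I g) v ∧
      ‖fderiv ℝ (conjChart I g) v - ContinuousLinearMap.id ℝ E‖ ≤ 1 / 2) ?_
  · simpa using this
  intro g _
  have hswap : Tendsto (Prod.swap : E × G → G × E) (𝓝 (extChartAt I (1 : G) 1, g))
      (𝓝 (g, extChartAt I (1 : G) 1)) := continuous_swap.tendsto _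
  have hc : ContinuousAt (fun p : G × E =>
      ‖fderiv ℝ (conjChart I p.1) p.2 - ContinuousLinearMap.id ℝ E‖)
      (g, extChartAt I (1 : G) 1) :=
    ((continuousAt_fderiv_conjChart I g).sub continuousAt_const).norm
  have h0 : ‖fderiv ℝ (conjChart I g) (extChartAt I (1 : G) 1) - ContinuousLinearMap.id ℝ E‖
      < 1 / 2 := by
    rw [show fderiv ℝ (conjChart I g) (extChartAt I (1 : G) 1) = ContinuousLinearMap.id ℝ E
      from h g]
    simp
  exact hswap.eventually ((eventually_differentiableAt_conjChart I g).and
    ((hc.eventually_lt_const h0).mono fun _ => le_of_lt))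

omit [LieGroup I ∞ G] in
theorem eventually_forall_conj_mem [IsTopologicalGroup G] {U : Set G} (hU : U ∈ 𝓝 (1 : G)) :
    ∀ᶠ x in 𝓝 (1 : G), ∀ g : G, g * x * g⁻¹ ∈ U := by
  have := isCompact_univ.eventually_forall_of_forall_eventually
    (x₀ := (1 : G)) (K := (Set.univ : Set G)) (P := fun x g => g * x * g⁻¹ ∈ U) ?_
  · simpa using this
  intro g _
  have hc : ContinuousAt (fun z : G × G => z.2 * z.1 * z.2⁻¹) (1, g) := by fun_prop
  exact hc.eventually_mem (by simpa using hU)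

/-- A compact Lie group whose adjoint representation is trivial has a neighbourhood of the
identity consisting of central elements. -/
theorem eventually_mem_center_of_lieAd_eq_one (h : ∀ g : G, lieAd I g = 1) :
    ∀ᶠ x in 𝓝 (1 : G), x ∈ Subgroup.center G := by
  have : IsTopologicalGroup G := topologicalGroup_of_lieGroup I ∞
  obtain ⟨δ, hδ, hball⟩ := Metric.eventually_nhds_iff_ball.1
    (eventually_forall_norm_fderiv_conjChart_sub_le I h)
  set φ := extChartAt I (1 : G)
  have hU : φ.source ∩ φ ⁻¹' Metric.ball (φ 1) δ ∈ 𝓝 (1 : G) :=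
    inter_mem (extChartAt_source_mem_nhds 1)
      ((continuousAt_extChartAt (1 : G)).preimage_mem_nhds (Metric.ball_mem_nhds _ hδ))
  filter_upwards [eventually_forall_conj_mem hU] with x hx
  refine Subgroup.mem_center_iff.2 fun k => ?_
  let v : G → E := fun g => φ (g * x * g⁻¹)
  have hv (g : G) : v g ∈ Metric.ball (φ 1) δ := (hx g).2
  have hconj (g k : G) : conjChart I g (v k) = v (g * k) := by
    simp only [v]
    rw [conjChart_extChartAt I g (hx k).1]
    simp [φ, mul_assoc]
  -- Mean value inequality for conjugation minus the identity, between `v 1` and `v k`: each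
  -- displacement from `v g` to `v (g * k)` nearly repeats `v k - v 1`.
  have hmv (g : G) : ‖v (g * k) - v g - (v k - v 1)‖ ≤ 1 / 2 * ‖v k - v 1‖ := by
    have := Convex.norm_image_sub_le_of_norm_hasFDerivWithin_le (𝕜 := ℝ)
      (f := fun u => conjChart I g u - u)
      (f' := fun u => fderiv ℝ (conjChart I g) u - ContinuousLinearMap.id ℝ E)
      (fun u hu => (((hball u hu g).1.hasFDerivAt).sub (hasFDerivAt_id u)).hasFDerivWithinAt)
      (fun u hu => (hball u hu g).2) (convex_ball (φ 1) δ) (hv 1) (hv k)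
    rw [hconj, hconj, mul_one] at this
    rwa [sub_sub_sub_comm] at this
  have hsum (m : ℕ) : ‖v (k ^ m) - v 1 - (m : ℝ) • (v k - v 1)‖ ≤ m * (1 / 2 * ‖v k - v 1‖) := by
    induction m with
    | zero => simp
    | succ m ih =>
      have e : v (k ^ (m + 1)) - v 1 - ((m + 1 : ℕ) : ℝ) • (v k - v 1) =
          (v (k ^ m) - v 1 - (m : ℝ) • (v k - v 1)) +
            (v (k ^ m * k) - v (k ^ m) - (v k - v 1)) := by
        rw [pow_succ]; push_cast; rw [add_smul, one_smul]; abel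
      rw [e]
      refine (norm_add_le _ _).trans ((add_le_add ih (hmv _)).trans_eq ?_)
      push_cast; ring
  have hzero : v k - v 1 = 0 := by
    by_contra hne
    have hpos := norm_pos_iff.2 hne
    -- By `hsum`, `v (k ^ m)` is at least (m/2)‖v k - v 1‖ away from `v 1`, while both lie in a ball
    -- of radius δ; large m is impossible.
    obtain ⟨m, hm⟩ := exists_nat_gt (2 * (2 * δ) / ‖v k - v 1‖)
    rw [div_lt_iff₀ hpos] at hm
    have h1 : ‖v (k ^ m) - v 1‖ < 2 * δ := by
      rw [← dist_eq_norm]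
      have h2 := dist_triangle_right (v (k ^ m)) (v 1) (φ 1)
      have h3 := hv (k ^ m)
      have h4 := hv 1
      rw [Metric.mem_ball] at h3 h4
      linarith
    have h2 := norm_sub_norm_le ((m : ℝ) • (v k - v 1)) (v (k ^ m) - v 1)
    rw [norm_sub_rev ((m : ℝ) • (v k - v 1)), norm_smul, Real.norm_natCast] at h2
    have h3 := hsum m
    linarith
  have hinj := φ.injOn (hx k).1 (hx 1).1 (sub_eq_zero.1 hzero)
  simpa [mul_inv_eq_iff_eq_mul] using hinj

theorem mul_comm_of_lieAd_eq_one [ConnectedSpace G] (h : ∀ g : G, lieAd I g = 1) (a b : G) :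
    a * b = b * a := by
  have : IsTopologicalGroup G := topologicalGroup_of_lieGroup I ∞
  have hopen : IsOpen (Subgroup.center G : Set G) :=
    Subgroup.isOpen_of_mem_nhds _ (g := 1) (eventually_mem_center_of_lieAd_eq_one I h)
  have htop : (Subgroup.center G : Set G) = Set.univ :=
    IsClopen.eq_univ ⟨Subgroup.isClosed_of_isOpen _ hopen, hopen⟩ ⟨1, one_mem _⟩
  have hb : b ∈ (Subgroup.center G : Set G) := by rw [htop]; trivial
  exact Subgroup.mem_center_iff.1 hb a

end Adjoint

/-- The identity component of a subgroup of a topological group. -/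
def Subgroup.identityComponent {G : Type*} [Group G] [TopologicalSpace G] [IsTopologicalGroup G]
    (K : Subgroup G) : Subgroup G where
  carrier := connectedComponentIn (K : Set G) 1
  one_mem' := mem_connectedComponentIn K.one_mem
  mul_mem' {a b} ha hb := by
    have hsub := connectedComponentIn_subset (K : Set G) 1
    have himg := (isPreconnected_connectedComponentIn (x := (1 : G)) (F := (K : Set G))).image
      (fun y => a * y) (continuous_const.mul continuous_id).continuousOn
    have hmem := himg.subset_connectedComponentIn (x := a) (F := (K : Set G))
      ⟨1, mem_connectedComponentIn K.one_mem, mul_one a⟩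
      (by rintro _ ⟨y, hy, rfl⟩; exact K.mul_mem (hsub ha) (hsub hy))
    rw [connectedComponentIn_eq ha]
    exact hmem ⟨b, hb, rfl⟩
  inv_mem' {a} ha := by
    have hsub := connectedComponentIn_subset (K : Set G) 1
    have himg := (isPreconnected_connectedComponentIn (x := (1 : G)) (F := (K : Set G))).image
      (fun y => y⁻¹) continuous_inv.continuousOn
    have hmem := himg.subset_connectedComponentIn (x := 1) (F := (K : Set G))
      ⟨1, mem_connectedComponentIn K.one_mem, inv_one⟩
      (by rintro _ ⟨y, hy, rfl⟩; exact K.inv_mem (hsub hy))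
    exact hmem ⟨a, ha, rfl⟩

/-! ### Identity components and simplicity -/

section IdentityComponent

variable {G : Type*} [Group G] [TopologicalSpace G] [IsTopologicalGroup G]

theorem Subgroup.identityComponent_le (K : Subgroup G) : K.identityComponent ≤ K :=
  connectedComponentIn_subset (K : Set G) 1

theorem Subgroup.isConnected_identityComponent (K : Subgroup G) :
    IsConnected (K.identityComponent : Set G) :=
  isConnected_connectedComponentIn_iff.2 K.one_mem

theorem Subgroup.isClosed_identityComponent {K : Subgroup G} (hK : IsClosed (K : Set G)) :
    IsClosed (K.identityComponent : Set G) := by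
  refine isClosed_of_closure_subset ?_
  exact K.isConnected_identityComponent.isPreconnected.closure.subset_connectedComponentIn
    (_root_.subset_closure K.identityComponent.one_mem)
    (closure_minimal K.identityComponent_le hK)

theorem Subgroup.normal_identityComponent (K : Subgroup G) [K.Normal] :
    K.identityComponent.Normal := ⟨fun n hn g => by
  have himg := K.isConnected_identityComponent.isPreconnected.image (fun y => g * y * g⁻¹)
    (by fun_prop)
  exact himg.subset_connectedComponentIn (x := 1) (F := (K : Set G))
    ⟨1, K.identityComponent.one_mem, by simp⟩
    (by rintro _ ⟨y, hy, rfl⟩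
        exact Subgroup.Normal.conj_mem inferInstance y (K.identityComponent_le hy) g)
    ⟨n, hn, rfl⟩⟩

/-- In a simple connected nonabelian group, a closed normal subgroup containing all commutators
is the whole group. -/
theorem IsLieSimple.eq_top_of_commutator_mem (hG : IsLieSimple G)
    (hnonab : ∃ a b : G, a * b ≠ b * a) {K : Subgroup G} [hn : K.Normal]
    (hK : IsClosed (K : Set G)) (hcomm : ∀ a b : G, a * b * a⁻¹ * b⁻¹ ∈ K) : K = ⊤ := by
  have := hG.connected
  rcases hG.eq_bot_or_eq_top K.identityComponent K.normal_identityComponent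
    (K.isClosed_identityComponent hK) K.isConnected_identityComponent with hbot | htop
  · obtain ⟨a, b, hab⟩ := hnonab
    -- For fixed b the commutators form a connected set through 1 inside K, hence lie in its
    -- identity component, here trivial.
    have himg := (isPreconnected_univ (α := G)).image (fun x => x * b * x⁻¹ * b⁻¹) (by fun_prop)
    have hmem : a * b * a⁻¹ * b⁻¹ ∈ K.identityComponent :=
      himg.subset_connectedComponentIn (x := 1) (F := (K : Set G))
        ⟨1, trivial, by simp⟩ (by rintro _ ⟨y, -, rfl⟩; exact hcomm y b) ⟨a, trivial, rfl⟩
    rw [hbot, Subgroup.mem_bot, mul_inv_eq_one, mul_inv_eq_iff_eq_mul] at hmem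
    exact absurd hmem hab
  · exact top_le_iff.1 (htop ▸ K.identityComponent_le)

end IdentityComponent

theorem mainTheorem10
    {E : Type*} [NormedAddCommGroup E] [NormedSpace ℝ E] [FiniteDimensional ℝ E]
    {H : Type*} [TopologicalSpace H] (I : ModelWithCorners ℝ E H) [I.Boundaryless]
    {G : Type*} [Group G] [TopologicalSpace G] [ChartedSpace H G] [LieGroup I ∞ G]
    [T2Space G] [CompactSpace G]
    (hsimple : IsLieSimple G) (hnonab : ∃ a b : G, a * b ≠ b * a) :
    ∃ g : G, ∀ S : Set G, IsEngelSink g S → ¬ S.Countable := by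
  have : IsTopologicalGroup G := topologicalGroup_of_lieGroup I ∞
  have : ConnectedSpace G := hsimple.connected
  by_contra! hcon
  let ρ : G →* (E →L[ℝ] E)ˣ := (lieAd I).toHomUnits
  have hρ : Continuous ρ := Units.continuous_iff.2 ⟨continuous_lieAd I, by
    have hinv : (fun g => ((ρ g)⁻¹ : (E →L[ℝ] E)ˣ).val) = fun g => lieAd I g⁻¹ := by
      funext g; rw [← map_inv]; rfl
    rw [hinv]
    exact (continuous_lieAd I).comp continuous_inv⟩
  have hcomm (a b : G) : ρ a * ρ b = ρ b * ρ a := by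
    obtain ⟨S, hS, hc⟩ := hcon a
    have hcpt : IsCompact (ρ.range : Set (E →L[ℝ] E)ˣ) := by
      rw [MonoidHom.coe_range]; exact isCompact_range hρ
    have hconn : IsConnected (ρ.range : Set (E →L[ℝ] E)ˣ) := by
      rw [MonoidHom.coe_range]; exact isConnected_range hρ
    exact congrArg Subtype.val <| (hS.image ρ.rangeRestrict_surjective).mul_comm_of_countable
      hcpt hconn (hc.image _) (ρ.rangeRestrict b)
  have hker : ρ.ker = ⊤ := by
    refine hsimple.eq_top_of_commutator_mem hnonab (isClosed_singleton.preimage hρ) fun a b => ?_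
    rw [MonoidHom.mem_ker, map_mul, map_mul, map_mul, map_inv, map_inv, hcomm a b]
    simp
  have hAd (g : G) : lieAd I g = 1 := by
    have hg : g ∈ ρ.ker := by rw [hker]; trivial
    exact congrArg Units.val (MonoidHom.mem_ker.1 hg)
  obtain ⟨a, b, hab⟩ := hnonab
  exact hab (mul_comm_of_lieAd_eq_one I hAd a b)
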